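/- A de Vries algebra is a pair $\mathfrak A=(A,\prec)$, where $A$ is a complete Boolean algebra and $\prec$ is a binary relation on $A$ such that: $1\prec 1$; $a\prec b$ implies $a\le b$; $a\le b\prec c\le d$ implies $a\prec d$; $a\prec b$ and $a\prec c$ imply $a\prec b\wedge c$; $a\prec b$ implies $\neg b\prec\neg a$; $a\prec b$ implies $a\prec c\prec b$ for some $c$; and $b=\bigvee\{a\in A\mid a\prec b\}$ for each $b$. A de Vries extension is an injective map $\alpha:\mathfrak A\to\mathfrak B$ between de Vries algebras such that - $\alpha(0)=0$; $\alpha(a\wedge b)=\alpha(a)\wedge\alpha(b)$; $a\prec b$ implies $\neg\alpha(\neg a)\prec\alpha(b)$; and $\alpha(b)=\bigvee\{\alpha(a)\mid a\prec b\}$; - $\mathfrak B$ is atomic, and its relation $\prec$ coincides with $\le$; - each element of $\mathfrak B$ is a join of meets of elements of $\alpha[\mathfrak A]$. A filter $F$ of $\mathfrak A$ is round if $F=\{a\mid b\prec a\text{ for some }b\in F\}$, and an ideal $I$ of $\mathfrak A$ is round if $I=\{a\mid a\prec b\text{ for some }b\in I\}$ (filters and ideals are nonempty but need not be proper). An end of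 $\mathfrak A$ is a maximal proper round filter. Let $Y_{\mathfrak A}$ be the set of ends with the topology having the sets $\zeta(a)=\{y\in Y_{\mathfrak A}\mid a\in y\}$, $a\in\mathfrak A$, as a basis. The dual space $X_{\mathfrak B}$ of $\alpha$ is the set of atoms of $\mathfrak B$ with the least topology making the map $$\alpha_*:X_{\mathfrak B}\to Y_{\mathfrak A},\qquad \alpha_*(x)=\{a\in\mathfrak A\mid c\prec a\text{ for some }c\in\mathfrak A\text{ with }x\le\alpha(c)\}$$ continuous. An element $a\in\mathfrak A$ is $\alpha$-compact if for every $S\subseteq\mathfrak A$ with $\neg\alpha(\neg a)\le\bigvee\alpha[S]$ there is a finite $T\subseteq S$ with $\neg\alpha(\neg a)\le\bigvee\alpha[T]$. Let $I_\alpha$ be the set of $\alpha$-compact elements of $\mathfrak A$. Theorem. Let $\alpha:\mathfrak A\to\mathfrak B$ be a de Vries extension. Then the following are equivalent. 1. $X_{\mathfrak B}$ is locally compact. 2. For each $b\in\mathfrak A$ we have $\alpha(b)=\bigvee\{\alpha(a)\mid a\in I_\alpha,\ a\prec b\}$. 3. $I_\alpha$ is a round ideal of $\mathfrak A$ with $\bigvee\alpha[I_\alpha]=1$.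 -/

import Mathlib

universe u v

/-- A de Vries algebra: a complete Boolean algebra with a de Vries proximity `Prox`. -/
class DeVriesAlgebra (A : Type u) extends CompleteBooleanAlgebra A where
  Prox : A → A → Prop
  prox_top : Prox ⊤ ⊤
  le_of_prox : ∀ a b : A, Prox a b → a ≤ b
  prox_of_le : ∀ a b c d : A, a ≤ b → Prox b c → c ≤ d → Prox a d
  prox_inf : ∀ a b c : A, Prox a b → Prox a c → Prox a (b ⊓ c)
  prox_compl : ∀ a b : A, Prox a b → Prox bᶜ aᶜ
  prox_interpolate : ∀ a b : A, Prox a b → ∃ c : A, Prox a c ∧ Prox c b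
  eq_sSup_prox : ∀ b : A, b = sSup {a : A | Prox a b}

namespace DeVries

infix:50 " ≺ " => DeVriesAlgebra.Prox

section Algebra

variable {A : Type u} [DeVriesAlgebra A]

/-- The set of all `a` with `b ≺ a` for some `b ∈ S`. -/
def upProx (S : Set A) : Set A := {a | ∃ b ∈ S, b ≺ a}

/-- The set of all `a` with `a ≺ b` for some `b ∈ S`. -/
def downProx (S : Set A) : Set A := {a | ∃ b ∈ S, a ≺ b}

/-- A round filter (not necessarily proper). -/
def IsRoundFilter (F : Set A) : Prop := Order.IsPFilter F ∧ upProx F = F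

/-- A round ideal (not necessarily proper). -/
def IsRoundIdeal (I : Set A) : Prop := Order.IsIdeal I ∧ downProx I = I

/-- An end: a maximal proper round filter. -/
def IsEnd (F : Set A) : Prop :=
  Maximal (fun G : Set A => IsRoundFilter G ∧ G ≠ Set.univ) F

variable (A) in
/-- The set `Y_A` of ends of `A`. -/
def Ends : Type u := {F : Set A // IsEnd F}

/-- The set `ζ(a)` of ends containing `a`. -/
def zeta (a : A) : Set (Ends A) := {y | a ∈ y.1}

/-- The topology on the space of ends generated by the sets `ζ(a)`; as `ζ(⊤)` is everything and
`ζ(a) ∩ ζ(b) = ζ(a ⊓ b)`, these sets form a basis. -/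
instance : TopologicalSpace (Ends A) :=
  TopologicalSpace.generateFrom (Set.range (zeta : A → Set (Ends A)))

variable (A) in
/-- A de Vries algebra is extremally disconnected if its proximity is its order. -/
def IsExtremallyDisconnected : Prop := ∀ a b : A, a ≺ b ↔ a ≤ b

end Algebra

section Morphism

variable {A : Type u} {B : Type v} [DeVriesAlgebra A] [DeVriesAlgebra B]

/-- De Vries morphisms. -/
structure IsDeVriesMorphism (ρ : A → B) : Prop where
  map_bot : ρ ⊥ = ⊥
  map_inf : ∀ a b : A, ρ (a ⊓ b) = ρ a ⊓ ρ b
  compl_map_compl_prox : ∀ a b : A, a ≺ b → (ρ aᶜ)ᶜ ≺ ρ b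
  eq_sSup : ∀ b : A, ρ b = sSup (ρ '' {a : A | a ≺ b})

/-- A subset `R` is join-meet dense if every element is a join of meets of elements of `R`. -/
def IsJoinMeetDense (R : Set B) : Prop :=
  ∀ b : B, ∃ 𝒮 : Set (Set B), (∀ S ∈ 𝒮, S ⊆ R) ∧ b = sSup (sInf '' 𝒮)

theorem IsDeVriesMorphism.map_top {ρ : A → B} (h : IsDeVriesMorphism ρ) : ρ ⊤ = ⊤ := by
  have h0 : (⊥ : A) ≺ ⊥ := by
    simpa using DeVriesAlgebra.prox_compl _ _ (DeVriesAlgebra.prox_top (A := A))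
  have h1 := DeVriesAlgebra.le_of_prox _ _ (h.compl_map_compl_prox _ _ h0)
  simpa [h.map_bot] using h1

theorem IsDeVriesMorphism.mono {ρ : A → B} (h : IsDeVriesMorphism ρ) {a b : A} (hab : a ≤ b) :
    ρ a ≤ ρ b := by
  have h1 := h.map_inf a b
  rw [inf_eq_left.mpr hab] at h1
  exact inf_eq_left.mp h1.symm

/-- For an atom `b` and a de Vries morphism `ρ`, the set of all `a` such that `c ≺ a` for some `c`
with `b ≤ ρ c` is an end. -/
theorem IsDeVriesMorphism.isEnd_upProx {ρ : A → B} (h : IsDeVriesMorphism ρ) {b : B}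
    (hb : IsAtom b) : IsEnd (upProx (ρ ⁻¹' Set.Ici b)) := by
  have hsub : ∀ c a : A, b ≤ ρ c → c ≺ a → a ∈ upProx (ρ ⁻¹' Set.Ici b) :=
    fun c a hc hca => ⟨c, hc, hca⟩
  refine ⟨⟨⟨?_, ?_⟩, ?_⟩, ?_⟩
  · refine Order.IsPFilter.of_def ?_ ?_ ?_
    · exact ⟨⊤, hsub ⊤ ⊤ (by rw [h.map_top]; exact le_top) DeVriesAlgebra.prox_top⟩
    · rintro x ⟨c, hc, hcx⟩ y ⟨d, hd, hdy⟩
      refine ⟨x ⊓ y, hsub (c ⊓ d) _ ?_ ?_, inf_le_left, inf_le_right⟩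
      · rw [h.map_inf]
        exact le_inf hc hd
      · exact DeVriesAlgebra.prox_inf _ _ _
          (DeVriesAlgebra.prox_of_le _ _ _ _ inf_le_left hcx le_rfl)
          (DeVriesAlgebra.prox_of_le _ _ _ _ inf_le_right hdy le_rfl)
    · rintro x y hxy ⟨c, hc, hcx⟩
      exact hsub c y hc (DeVriesAlgebra.prox_of_le _ _ _ _ le_rfl hcx hxy)
  · ext a
    constructor
    · rintro ⟨d, ⟨c, hc, hcd⟩, hda⟩
      exact hsub c a hc
        (DeVriesAlgebra.prox_of_le _ _ _ _ (DeVriesAlgebra.le_of_prox _ _ hcd) hda le_rfl)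
    · rintro ⟨c, hc, hca⟩
      obtain ⟨d, hcd, hda⟩ := DeVriesAlgebra.prox_interpolate _ _ hca
      exact ⟨d, hsub c d hc hcd, hda⟩
  · intro hu
    have h0 : (⊥ : A) ∈ upProx (ρ ⁻¹' Set.Ici b) := by rw [hu]; trivial
    obtain ⟨c, hc, hc0⟩ := h0
    have hc1 : c = ⊥ := le_bot_iff.mp (DeVriesAlgebra.le_of_prox _ _ hc0)
    have hc2 : b ≤ ρ c := hc
    rw [hc1, h.map_bot] at hc2
    exact hb.1 (le_bot_iff.mp hc2)
  · rintro G ⟨⟨hGf, hGr⟩, hGp⟩ hFG a ha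
    rw [← hGr] at ha
    obtain ⟨c, hcG, hca⟩ := ha
    obtain ⟨d, hcd, hda⟩ := DeVriesAlgebra.prox_interpolate _ _ hca
    obtain ⟨e, hce, hed⟩ := DeVriesAlgebra.prox_interpolate _ _ hcd
    by_cases hbd : b ≤ ρ d
    · exact hsub d a hbd hda
    · exfalso
      have h1 : Disjoint b (ρ d) := hb.not_le_iff_disjoint.mp hbd
      have h2 : b ≤ (ρ d)ᶜ := le_compl_iff_disjoint_right.mpr h1
      have h3 : (ρ eᶜ)ᶜ ≤ ρ d :=
        DeVriesAlgebra.le_of_prox _ _ (h.compl_map_compl_prox _ _ hed)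
      have h4 : b ≤ ρ eᶜ := h2.trans (compl_le_iff_compl_le.mp h3)
      have h5 : cᶜ ∈ G := hFG (hsub _ _ h4 (DeVriesAlgebra.prox_compl _ _ hce))
      let P : Order.PFilter A := hGf.toPFilter
      have h6 : c ⊓ cᶜ ∈ P := Order.PFilter.inf_mem hcG h5
      apply hGp
      ext z
      simp only [Set.mem_univ, iff_true]
      have h7 : z ∈ P := Order.PFilter.mem_of_le (by simp) h6
      exact h7

end Morphism

/-- A de Vries extension: a one-to-one de Vries morphism from a de Vries algebra to an atomic
extremally disconnected de Vries algebra with join-meet dense image. -/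
structure DeVriesExtension (A : Type u) (B : Type v) [DeVriesAlgebra A] [DeVriesAlgebra B] where
  toFun : A → B
  isDeVriesMorphism : IsDeVriesMorphism toFun
  injective : Function.Injective toFun
  isAtomic : IsAtomic B
  isExtremallyDisconnected : IsExtremallyDisconnected B
  isJoinMeetDense : IsJoinMeetDense (Set.range toFun)

namespace DeVriesExtension

variable {A : Type u} {B : Type v} [DeVriesAlgebra A] [DeVriesAlgebra B]

instance : CoeFun (DeVriesExtension A B) (fun _ => A → B) := ⟨toFun⟩

/-- The dual space `X_B` of a de Vries extension: the set of atoms of `B`, topologized below. -/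
def DualSpace (_α : DeVriesExtension A B) : Type v := {b : B // IsAtom b}

/-- The map `α_* : X_B → Y_A`, sending an atom `b` to the end of all `a` such that `c ≺ a` for
some `c` with `b ≤ α c`. -/
def dualMap (α : DeVriesExtension A B) (b : α.DualSpace) : Ends A :=
  ⟨upProx (α ⁻¹' Set.Ici b.1), α.isDeVriesMorphism.isEnd_upProx b.2⟩

/-- The least topology on `X_B` making `α_*` continuous. -/
instance (α : DeVriesExtension A B) : TopologicalSpace α.DualSpace :=
  TopologicalSpace.induced α.dualMap inferInstance

/-- `α`-compact elements of `A`. -/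
def IsCompactElem (α : DeVriesExtension A B) (a : A) : Prop :=
  ∀ S : Set A, (α aᶜ)ᶜ ≤ sSup (α '' S) →
    ∃ T : Set A, T ⊆ S ∧ T.Finite ∧ (α aᶜ)ᶜ ≤ sSup (α '' T)

/-- The set `I_α` of `α`-compact elements. -/
def compactElems (α : DeVriesExtension A B) : Set A := {a | α.IsCompactElem a}

end DeVriesExtension

end DeVries

namespace DeVries

section Algebra

variable {A : Type u} [DeVriesAlgebra A]

/-! Write O(a) for the atoms below `α a` and C(a) for those below `(α aᶜ)ᶜ`. The sets O(a) form a
basis of the dual space, each C(a) is closed, O(a) ⊆ C(a), and a ≺ b gives C(a) ⊆ O(b). Every atom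
in O(b) lies in O(a) for some a ≺ b, so the C(a) with a ≺ b are closed neighbourhoods inside O(b).
As B is atomic, inequalities with joins are covering statements, and a is `α`-compact exactly when
C(a) is compact. Local compactness thus says that `α`-compact a ≺ b suffice to cover O(b), which is
condition 2. Taking b = ⊤ gives a cover of the whole space, and such a cover already forces both
roundness of the ideal of compact elements and local compactness. -/

theorem bot_prox_bot : (⊥ : A) ≺ ⊥ := by
  simpa using DeVriesAlgebra.prox_compl _ _ (DeVriesAlgebra.prox_top (A := A))

theorem prox_sup_left {a b c : A} (ha : a ≺ c) (hb : b ≺ c) : a ⊔ b ≺ c := by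
  simpa using DeVriesAlgebra.prox_compl _ _ (DeVriesAlgebra.prox_inf _ _ _
    (DeVriesAlgebra.prox_compl _ _ ha) (DeVriesAlgebra.prox_compl _ _ hb))

end Algebra

namespace DeVriesExtension

variable {A : Type u} {B : Type v} [DeVriesAlgebra A] [DeVriesAlgebra B]
  (α : DeVriesExtension A B)

/-- An atom is completely join-prime, and `α a` is the join of the `α c` with `c ≺ a`. -/
theorem exists_prox_of_atom_le {b : B} (hb : IsAtom b) {a : A} (h : b ≤ α a) :
    ∃ c, c ≺ a ∧ b ≤ α c := by
  rw [α.isDeVriesMorphism.eq_sSup, hb.le_sSup] at h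
  obtain ⟨_, ⟨c, hc, rfl⟩, hbc⟩ := h
  exact ⟨c, hc, hbc⟩

theorem exists_atom_le_of_not_le (α : DeVriesExtension A B) {b c : B} (h : ¬ b ≤ c) :
    ∃ x, IsAtom x ∧ x ≤ b ∧ ¬ x ≤ c := by
  have := α.isAtomic
  by_contra! H
  exact h (BooleanAlgebra.le_iff_atom_le_imp.mpr H)

theorem compl_map_compl_le {a b : A} (h : a ≺ b) : (α aᶜ)ᶜ ≤ α b :=
  DeVriesAlgebra.le_of_prox _ _ (α.isDeVriesMorphism.compl_map_compl_prox a b h)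

theorem map_le_compl_map_compl (a : A) : α a ≤ (α aᶜ)ᶜ := by
  rw [le_compl_iff_disjoint_right, disjoint_iff, ← α.isDeVriesMorphism.map_inf, inf_compl_self,
    α.isDeVriesMorphism.map_bot]

theorem compl_map_compl_mono {a b : A} (h : a ≤ b) : (α aᶜ)ᶜ ≤ (α bᶜ)ᶜ :=
  compl_le_compl (α.isDeVriesMorphism.mono (compl_le_compl h))

theorem compl_map_compl_sup (a b : A) : (α (a ⊔ b)ᶜ)ᶜ = (α aᶜ)ᶜ ⊔ (α bᶜ)ᶜ := by
  rw [compl_sup, α.isDeVriesMorphism.map_inf, compl_inf]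

theorem le_of_map_le {a b : A} (h : α a ≤ α b) : a ≤ b :=
  inf_eq_left.mp (α.injective (by rw [α.isDeVriesMorphism.map_inf, inf_eq_left.mpr h]))

/-- The basic open set of atoms below `α a`. -/
def basicOpen (a : A) : Set α.DualSpace := {x | x.1 ≤ α a}

theorem preimage_zeta (a : A) : α.dualMap ⁻¹' zeta a = α.basicOpen a := by
  ext x
  constructor
  · rintro ⟨c, hc, hca⟩
    exact le_trans hc (α.isDeVriesMorphism.mono (DeVriesAlgebra.le_of_prox _ _ hca))
  · intro h
    obtain ⟨c, hca, hc⟩ := α.exists_prox_of_atom_le x.2 h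
    exact ⟨c, hc, hca⟩

theorem isTopologicalBasis_basicOpen :
    TopologicalSpace.IsTopologicalBasis (Set.range α.basicOpen) where
  exists_subset_inter := by
    rintro _ ⟨a, rfl⟩ _ ⟨b, rfl⟩ x ⟨ha, hb⟩
    refine ⟨_, ⟨a ⊓ b, rfl⟩, ?_, ?_⟩
    · change x.1 ≤ α (a ⊓ b)
      rw [α.isDeVriesMorphism.map_inf]
      exact le_inf ha hb
    · exact fun y hy => ⟨le_trans hy (α.isDeVriesMorphism.mono inf_le_left),
        le_trans hy (α.isDeVriesMorphism.mono inf_le_right)⟩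
  sUnion_eq := Set.eq_univ_of_forall fun x =>
    ⟨_, ⟨⊤, rfl⟩, by
      change x.1 ≤ α ⊤
      rw [α.isDeVriesMorphism.map_top]
      exact le_top⟩
  eq_generateFrom := by
    change TopologicalSpace.induced α.dualMap (TopologicalSpace.generateFrom _) = _
    rw [induced_generateFrom_eq, ← Set.range_comp]
    congr 2
    ext1 a
    exact α.preimage_zeta a

theorem isOpen_basicOpen (a : A) : IsOpen (α.basicOpen a) :=
  α.isTopologicalBasis_basicOpen.isOpen ⟨a, rfl⟩

/-- The closed set of atoms below `(α aᶜ)ᶜ`, which is the closure of `basicOpen a`. -/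
def basicClosed (a : A) : Set α.DualSpace := {x | x.1 ≤ (α aᶜ)ᶜ}

theorem basicClosed_eq_compl (a : A) : α.basicClosed a = (α.basicOpen aᶜ)ᶜ := by
  ext x
  change x.1 ≤ (α aᶜ)ᶜ ↔ ¬ x.1 ≤ α aᶜ
  rw [le_compl_iff_disjoint_right, x.2.not_le_iff_disjoint]

theorem isClosed_basicClosed (a : A) : IsClosed (α.basicClosed a) := by
  rw [basicClosed_eq_compl]
  exact (α.isOpen_basicOpen _).isClosed_compl

theorem basicOpen_subset_basicClosed (a : A) : α.basicOpen a ⊆ α.basicClosed a :=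
  fun _ hx => le_trans hx (α.map_le_compl_map_compl a)

theorem basicClosed_subset_basicOpen {a b : A} (h : a ≺ b) :
    α.basicClosed a ⊆ α.basicOpen b :=
  fun _ hx => le_trans hx (α.compl_map_compl_le h)

theorem compl_map_compl_le_sSup_iff (a : A) (S : Set A) :
    (α aᶜ)ᶜ ≤ sSup (α '' S) ↔ α.basicClosed a ⊆ ⋃ s ∈ S, α.basicOpen s := by
  constructor
  · intro h x hx
    obtain ⟨_, ⟨s, hs, rfl⟩, hxs⟩ := x.2.le_sSup.mp (le_trans hx h)
    exact Set.mem_biUnion hs hxs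
  · intro h
    by_contra hn
    obtain ⟨x, hx, hxa, hxS⟩ := α.exists_atom_le_of_not_le hn
    obtain ⟨s, hs, hxs⟩ := Set.mem_iUnion₂.mp (h (show (⟨x, hx⟩ : α.DualSpace) ∈ _ from hxa))
    exact hxS (le_trans hxs (le_sSup ⟨s, hs, rfl⟩))

/-- Compactness need only be tested on covers by basic open sets. -/
theorem isCompactElem_iff_isCompact (a : A) :
    α.IsCompactElem a ↔ IsCompact (α.basicClosed a) := by
  constructor
  · intro h
    refine isCompact_of_finite_subcover fun {ι} U hU hcov => ?_
    -- Refine the cover to all basic open sets contained in some `U i`.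
    have hS : (α aᶜ)ᶜ ≤ sSup (α '' {s | ∃ i, α.basicOpen s ⊆ U i}) := by
      rw [compl_map_compl_le_sSup_iff]
      intro x hx
      obtain ⟨i, hi⟩ := Set.mem_iUnion.mp (hcov hx)
      obtain ⟨_, ⟨s, rfl⟩, hxs, hsU⟩ :=
        α.isTopologicalBasis_basicOpen.exists_subset_of_mem_open hi (hU i)
      exact Set.mem_biUnion (show s ∈ {s | ∃ i, α.basicOpen s ⊆ U i} from ⟨i, hsU⟩) hxs
    obtain ⟨T, hTS, hT, haT⟩ := h _ hS
    rw [compl_map_compl_le_sSup_iff] at haT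
    choose f hf using fun t : T => hTS t.2
    classical
    have := hT.fintype
    refine ⟨Finset.univ.image f, fun x hx => ?_⟩
    obtain ⟨t, ht, hxt⟩ := Set.mem_iUnion₂.mp (haT hx)
    exact Set.mem_biUnion (Finset.mem_coe.mpr
      (Finset.mem_image_of_mem f (Finset.mem_univ ⟨t, ht⟩))) (hf ⟨t, ht⟩ hxt)
  · intro h S hS
    rw [compl_map_compl_le_sSup_iff] at hS
    obtain ⟨T, hTS, hT, haT⟩ := h.elim_finite_subcover_image
      (fun s _ => α.isOpen_basicOpen s) hS
    exact ⟨T, hTS, hT, (α.compl_map_compl_le_sSup_iff a T).mpr haT⟩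

theorem IsCompactElem.mono {α : DeVriesExtension A B} {a b : A} (hb : α.IsCompactElem b)
    (hab : a ≤ b) : α.IsCompactElem a := by
  rw [isCompactElem_iff_isCompact] at hb ⊢
  exact hb.of_isClosed_subset (α.isClosed_basicClosed a)
    fun _ hx => le_trans hx (α.compl_map_compl_mono hab)

theorem isCompactElem_bot : α.IsCompactElem ⊥ := fun S _ =>
  ⟨∅, Set.empty_subset S, Set.finite_empty, by simp [α.isDeVriesMorphism.map_top]⟩

theorem IsCompactElem.sup {α : DeVriesExtension A B} {a b : A} (ha : α.IsCompactElem a)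
    (hb : α.IsCompactElem b) : α.IsCompactElem (a ⊔ b) := by
  intro S hS
  rw [compl_map_compl_sup, sup_le_iff] at hS
  obtain ⟨T, hTS, hT, haT⟩ := ha S hS.1
  obtain ⟨T', hTS', hT', haT'⟩ := hb S hS.2
  refine ⟨T ∪ T', Set.union_subset hTS hTS', hT.union hT', ?_⟩
  rw [compl_map_compl_sup, Set.image_union, sSup_union]
  exact sup_le_sup haT haT'

theorem isIdeal_compactElems : Order.IsIdeal α.compactElems where
  IsLowerSet _ _ hab ha := IsCompactElem.mono ha hab
  Nonempty := ⟨⊥, α.isCompactElem_bot⟩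
  Directed a ha b hb := ⟨a ⊔ b, IsCompactElem.sup ha hb, le_sup_left, le_sup_right⟩

theorem exists_isCompactElem_of_locallyCompactSpace [LocallyCompactSpace α.DualSpace]
    {x : B} (hx : IsAtom x) {b : A} (hxb : x ≤ α b) :
    ∃ a, α.IsCompactElem a ∧ a ≺ b ∧ x ≤ α a := by
  obtain ⟨K, hK, hKb, hKc⟩ := local_compact_nhds
    ((α.isOpen_basicOpen b).mem_nhds (show (⟨x, hx⟩ : α.DualSpace) ∈ _ from hxb))
  obtain ⟨_, ⟨c, rfl⟩, hxc, hcK⟩ := α.isTopologicalBasis_basicOpen.mem_nhds_iff.mp hK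
  -- Shrinking below `c ⊓ b` secures both properties of `a`: `a ≺ c` puts its closed set inside the
  -- compact `K`, and `a ≺ b` is required.
  have hxcb : x ≤ α (c ⊓ b) := by
    rw [α.isDeVriesMorphism.map_inf]
    exact le_inf hxc hxb
  obtain ⟨a, ha, hxa⟩ := α.exists_prox_of_atom_le hx hxcb
  refine ⟨a, ?_, DeVriesAlgebra.prox_of_le _ _ _ _ le_rfl ha inf_le_right, hxa⟩
  rw [isCompactElem_iff_isCompact]
  exact hKc.of_isClosed_subset (α.isClosed_basicClosed a)
    ((α.basicClosed_subset_basicOpen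
      (DeVriesAlgebra.prox_of_le _ _ _ _ le_rfl ha inf_le_left)).trans hcK)

/-- `α` need not preserve joins, but it is monotone, so the finite join of `T` in `A` serves as `t`;
directedness of `I` supplies a common bound. -/
theorem exists_sSup_image_le_map_of_finite {I T : Set A} (hI : Order.IsIdeal I) (hT : T.Finite)
    (hTI : T ⊆ downProx I) : ∃ t ∈ downProx I, sSup (α '' T) ≤ α t := by
  induction T, hT using Set.Finite.induction_on with
  | empty =>
    obtain ⟨s, hs⟩ := hI.Nonempty
    exact ⟨⊥, ⟨s, hs, DeVriesAlgebra.prox_of_le _ _ _ _ le_rfl bot_prox_bot bot_le⟩, by simp⟩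
  | @insert a T _ _ ih =>
    obtain ⟨t, ⟨s, hs, hts⟩, ht⟩ := ih ((Set.subset_insert a T).trans hTI)
    obtain ⟨s', hs', has'⟩ := hTI (Set.mem_insert a T)
    obtain ⟨r, hr, hsr, hsr'⟩ := hI.Directed s hs s' hs'
    refine ⟨a ⊔ t, ⟨r, hr, prox_sup_left (DeVriesAlgebra.prox_of_le _ _ _ _ le_rfl has' hsr')
      (DeVriesAlgebra.prox_of_le _ _ _ _ le_rfl hts hsr)⟩, ?_⟩
    rw [Set.image_insert_eq, sSup_insert]
    exact sup_le (α.isDeVriesMorphism.mono le_sup_left)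
      (ht.trans (α.isDeVriesMorphism.mono le_sup_right))

theorem isRoundIdeal_compactElems (h : sSup (α '' α.compactElems) = ⊤) :
    IsRoundIdeal α.compactElems := by
  refine ⟨α.isIdeal_compactElems, Set.Subset.antisymm ?_ fun a ha => ?_⟩
  · rintro a ⟨b, hb, hab⟩
    exact IsCompactElem.mono hb (DeVriesAlgebra.le_of_prox _ _ hab)
  -- Compactness of `a` itself yields roundness: the elements `≺`-below compact ones already cover,
  -- so finitely many cover `a`.
  · have hcov : (α aᶜ)ᶜ ≤ sSup (α '' downProx α.compactElems) := by
      rw [compl_map_compl_le_sSup_iff]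
      intro x _
      obtain ⟨_, ⟨s, hs, rfl⟩, hxs⟩ := x.2.le_sSup.mp (le_top.trans_eq h.symm)
      obtain ⟨t, hts, hxt⟩ := α.exists_prox_of_atom_le x.2 hxs
      exact Set.mem_biUnion (show t ∈ downProx _ from ⟨s, hs, hts⟩) hxt
    obtain ⟨T, hTS, hT, haT⟩ := ha _ hcov
    obtain ⟨t, ⟨s, hs, hts⟩, ht⟩ :=
      α.exists_sSup_image_le_map_of_finite α.isIdeal_compactElems hT hTS
    have hat : a ≤ t := α.le_of_map_le ((α.map_le_compl_map_compl a).trans (haT.trans ht))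
    exact ⟨s, hs, DeVriesAlgebra.prox_of_le _ _ _ _ hat hts le_rfl⟩

/-- Each point lies in O(c) for some compact `c`; any `a ≺ c ⊓ b` is then compact, and its closed
set is a neighbourhood within O(b) of the points of O(a). -/
theorem locallyCompactSpace_of_sSup_eq_top (h : sSup (α '' α.compactElems) = ⊤) :
    LocallyCompactSpace α.DualSpace := by
  refine ⟨fun x n hn => ?_⟩
  obtain ⟨_, ⟨b, rfl⟩, hxb, hbn⟩ := α.isTopologicalBasis_basicOpen.mem_nhds_iff.mp hn
  obtain ⟨_, ⟨c, hc, rfl⟩, hxc⟩ := x.2.le_sSup.mp (le_top.trans_eq h.symm)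
  have hxcb : x.1 ≤ α (c ⊓ b) := by
    rw [α.isDeVriesMorphism.map_inf]
    exact le_inf hxc hxb
  obtain ⟨a, ha, hxa⟩ := α.exists_prox_of_atom_le x.2 hxcb
  refine ⟨α.basicClosed a, Filter.mem_of_superset ((α.isOpen_basicOpen a).mem_nhds hxa)
    (α.basicOpen_subset_basicClosed a), ?_, (α.isCompactElem_iff_isCompact a).mp
      (IsCompactElem.mono hc ((DeVriesAlgebra.le_of_prox _ _ ha).trans inf_le_left))⟩
  exact (α.basicClosed_subset_basicOpen
    (DeVriesAlgebra.prox_of_le _ _ _ _ le_rfl ha inf_le_right)).trans hbn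

end DeVriesExtension

end DeVries

theorem mainTheorem5 {A : Type u} {B : Type v} [DeVriesAlgebra A] [DeVriesAlgebra B]
    (α : DeVries.DeVriesExtension A B) :
    List.TFAE [
      LocallyCompactSpace α.DualSpace,
      ∀ b : A, α b = sSup {x : B | ∃ a ∈ α.compactElems, DeVriesAlgebra.Prox a b ∧ α a = x},
      DeVries.IsRoundIdeal α.compactElems ∧ sSup (α '' α.compactElems) = ⊤] := by
  tfae_have 1 → 2 := by
    intro _ b
    apply le_antisymm
    · by_contra hn
      obtain ⟨x, hx, hxb, hxS⟩ := α.exists_atom_le_of_not_le hn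
      obtain ⟨a, ha, hab, hxa⟩ := α.exists_isCompactElem_of_locallyCompactSpace hx hxb
      exact hxS (hxa.trans (le_sSup ⟨a, ha, hab, rfl⟩))
    · refine sSup_le ?_
      rintro _ ⟨a, -, hab, rfl⟩
      exact α.isDeVriesMorphism.mono (DeVriesAlgebra.le_of_prox _ _ hab)
  tfae_have 2 → 3 := by
    intro h
    have htop : sSup (α '' α.compactElems) = ⊤ := by
      rw [eq_top_iff, ← α.isDeVriesMorphism.map_top]
      rw [h ⊤]
      refine sSup_le_sSup ?_
      rintro _ ⟨a, ha, -, rfl⟩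
      exact ⟨a, ha, rfl⟩
    exact ⟨α.isRoundIdeal_compactElems htop, htop⟩
  tfae_have 3 → 1 := fun h => α.locallyCompactSpace_of_sSup_eq_top h.2
  tfae_finish
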